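/- Theorem 3.2. Let $n\ge 2$ and let $\Omega\subset\mathbb R^n$ be a bounded open set. There is a constant $\tau_0=\tau_0(\Omega)>0$, depending only on $\Omega$, with the following property. Let $f,g$ be positive continuous functions on $\Omega$ with $\int_\Omega f(x)\,dx<\infty$, let $1\le p\le q<\infty$, $\delta\in(0,1)$ and $\tau\in(0,\tau_0)$. For a continuous function $u:\Omega\to\mathbb R$ write $$g_u^\tau(x)=\int_{\Omega\cap B(x,\tau d(x,\partial\Omega))}\frac{|u(x)-u(y)|^p}{|x-y|^{n+p\delta}}\,dy ,\qquad u_{\Omega,f}=\frac{\int_\Omega u(x)f(x)\,dx}{\int_\Omega f(x)\,dx}.$$ Assume that for every ball $B\subset\subset\Omega$ (that is, $B\subset\Omega$ and $d(B,\partial\Omega)>0$) there is a finite constant $C_B$ such that $$\Big(\int_\Omega|u(x)|^q f(x)\,dx\Big)^{1/q}\le C_B\Big(\int_\Omega g_u^\tau(x)g(x)\,dx\Big)^{1/p}\qquad\text{for all } u\in C(\Omega)\text{ with } u|_B=0 .$$ Then there is a finite constant $C$, independent of $u$, such that for every $u\in C(\Omega)$ $$\Big(\int_\Omega|u(x)-u_{\Omega,f}|^q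 f(x)\,dx\Big)^{1/q}\le C\Big(\int_\Omega g_u^\tau(x)g(x)\,dx\Big)^{1/p}.$$ Here the integrals of non-negative functions may be infinite; whenever the right-hand side is finite, $uf$ is integrable over $\Omega$, so that $u_{\Omega,f}$ is well defined (and when it is infinite, there is nothing to prove). -/

import Mathlib

open MeasureTheory Metric Set
open scoped ENNReal NNReal

noncomputable section

namespace WeightedFractional

/-- `B ⊂⊂ Ω`: `B` is a subset of `Ω` at positive Euclidean distance from the boundary of `Ω`. -/
def CompactlyInside {n : ℕ} (B Ω : Set (EuclideanSpace ℝ (Fin n))) : Prop :=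
  B ⊆ Ω ∧ 0 < ⨅ x ∈ B, Metric.infEDist x (frontier Ω)

/-- The function `g_u^τ(x) = ∫_{Ω ∩ B(x, τ d(x, ∂Ω))} |u(x) - u(y)|^p / |x - y|^(n + p δ) dy`,
with values in `[0, ∞]`. -/
def gFun {n : ℕ} (Ω : Set (EuclideanSpace ℝ (Fin n))) (p δ τ : ℝ)
    (u : EuclideanSpace ℝ (Fin n) → ℝ) (x : EuclideanSpace ℝ (Fin n)) : ℝ≥0∞ :=
  ∫⁻ y in Ω ∩ Metric.ball x (τ * Metric.infDist x (frontier Ω)),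
    ENNReal.ofReal (|u x - u y| ^ p / ‖x - y‖ ^ ((n : ℝ) + p * δ))

/-- The weighted fractional energy `(∫_Ω g_u^τ(x) g(x) dx)^(1/p)`, with values in `[0, ∞]`. -/
def fracSeminorm {n : ℕ} (Ω : Set (EuclideanSpace ℝ (Fin n)))
    (g : EuclideanSpace ℝ (Fin n) → ℝ) (p δ τ : ℝ)
    (u : EuclideanSpace ℝ (Fin n) → ℝ) : ℝ≥0∞ :=
  (∫⁻ x in Ω, gFun Ω p δ τ u x * ENNReal.ofReal (g x)) ^ (1 / p)

/-- The weighted norm `(∫_Ω |u(x)|^q f(x) dx)^(1/q)`, with values in `[0, ∞]`. -/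
def weightedNorm {n : ℕ} (Ω : Set (EuclideanSpace ℝ (Fin n)))
    (f : EuclideanSpace ℝ (Fin n) → ℝ) (q : ℝ)
    (u : EuclideanSpace ℝ (Fin n) → ℝ) : ℝ≥0∞ :=
  (∫⁻ x in Ω, ENNReal.ofReal (|u x| ^ q * f x)) ^ (1 / q)

/-- The `f`-average `u_{Ω,f} = ∫_Ω u f / ∫_Ω f`. -/
def weightedAverage {n : ℕ} (Ω : Set (EuclideanSpace ℝ (Fin n)))
    (f u : EuclideanSpace ℝ (Fin n) → ℝ) : ℝ :=
  (∫ x in Ω, u x * f x) / ∫ x in Ω, f x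

end WeightedFractional

end

/-! Fix `x₀ ∈ Ω` and a cutoff `φ` equal to 1 on `ball x₀ r` and 0 off `S = ball x₀ (2 * r)`. For any
constant `c`, `u - c = (1 - φ)(u - c) + φ(u - c)`. The first summand vanishes on `ball x₀ r`, the
second on a ball disjoint from `S`, so the hypothesis applies to both. It remains to bound their
energies by that of `u`.

The increments of `φ(u - c)` exceed those of `u` by at most `r⁻¹ * ‖x - y‖ * (V x + V y)`, where `V`
is `|u - c|` on `S` and 0 elsewhere. Since `δ < 1`, the resulting kernel `‖z‖ ^ (p - n - pδ)` is
integrable near 0, and Tonelli bounds the extra energy by a multiple of `∫ V ^ p`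
(`lintegral_gFun_le`). Only points `x` near `S` contribute, and these stay in a compact subset of
`Ω`, where `g` is bounded above and below. As `S` is so small that all its pairs of points interact,
`∫ V ^ p` is in turn bounded by the energy of `u` for a suitable `c`
(`exists_lintegral_sub_rpow_le`). Finally `c` is traded for the weighted average
(`eLpNorm_sub_average_le`). -/

noncomputable section

namespace WeightedFractional

/-! ### Distance to the boundary -/

section Geometry

variable {n : ℕ} {Ω : Set (EuclideanSpace ℝ (Fin n))}

lemma ball_infDist_frontier_subset {x : EuclideanSpace ℝ (Fin n)} (ho : IsOpen Ω) (hx : x ∈ Ω) :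
    ball x (infDist x (frontier Ω)) ⊆ Ω := by
  rcases (infDist_nonneg (x := x) (s := frontier Ω)).eq_or_lt with h | h
  · simp [← h]
  -- A connected set that meets `Ω` but not its boundary stays in `Ω`.
  refine (convex_ball x _).isPreconnected.subset_of_closure_inter_subset ho
    ⟨x, mem_ball_self h, hx⟩ ?_
  rintro y ⟨hyc, hyb⟩
  by_contra hy
  have hyf : y ∈ frontier Ω := by rw [ho.frontier_eq]; exact ⟨hyc, hy⟩
  have := infDist_le_dist_of_mem (x := x) hyf
  rw [mem_ball, dist_comm] at hyb
  linarith

lemma infDist_frontier_pos {x : EuclideanSpace ℝ (Fin n)} (hn : 1 ≤ n) (ho : IsOpen Ω)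
    (hb : Bornology.IsBounded Ω) (hx : x ∈ Ω) : 0 < infDist x (frontier Ω) := by
  have : Nonempty (Fin n) := ⟨⟨0, hn⟩⟩
  have hne : (frontier Ω).Nonempty := by
    rw [nonempty_frontier_iff]
    refine ⟨⟨x, hx⟩, ?_⟩
    rintro rfl
    -- The frontier must be shown nonempty because `infDist` to the empty set is 0 by convention.
    exact NormedSpace.unbounded_univ ℝ (EuclideanSpace ℝ (Fin n)) hb
  rw [← isClosed_frontier.notMem_iff_infDist_pos hne, ho.frontier_eq]
  exact fun h => h.2 hx

lemma isCompact_inter_infDist_frontier (ho : IsOpen Ω) (hb : Bornology.IsBounded Ω) {c : ℝ}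
    (hc : 0 < c) : IsCompact {x ∈ Ω | c ≤ infDist x (frontier Ω)} := by
  have : {x ∈ Ω | c ≤ infDist x (frontier Ω)}
      = closure Ω ∩ {x | c ≤ infDist x (frontier Ω)} := by
    ext x
    refine ⟨fun h => ⟨subset_closure h.1, h.2⟩, fun h => ⟨?_, h.2⟩⟩
    by_contra hx
    have hxf : x ∈ frontier Ω := by rw [ho.frontier_eq]; exact ⟨h.1, hx⟩
    have h2 := h.2
    rw [mem_ofPred_eq, infDist_zero_of_mem hxf] at h2
    linarith
  rw [this]
  exact (isCompact_of_isClosed_isBounded isClosed_closure hb.closure).inter_right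
    (isClosed_le continuous_const (continuous_infDist_pt _))

lemma compactlyInside_ball {x₀ x : EuclideanSpace ℝ (Fin n)} {r : ℝ} (ho : IsOpen Ω)
    (hx₀ : x₀ ∈ Ω) (h : dist x x₀ + r < infDist x₀ (frontier Ω)) :
    CompactlyInside (ball x r) Ω := by
  have key : ∀ y ∈ ball x r, dist y x₀ < dist x x₀ + r := fun y hy => by
    have := dist_triangle y x x₀
    rw [mem_ball] at hy
    linarith
  refine ⟨fun y hy => ball_infDist_frontier_subset ho hx₀ (mem_ball.2 ((key y hy).trans h)), ?_⟩
  refine lt_of_lt_of_le (b := ENNReal.ofReal (infDist x₀ (frontier Ω) - (dist x x₀ + r)))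
    (by simpa using h) (le_iInf₂ fun y hy => ?_)
  refine ENNReal.ofReal_le_of_le_toReal ?_
  change _ ≤ infDist y (frontier Ω)
  have := infDist_le_infDist_add_dist (s := frontier Ω) (x := x₀) (y := y)
  have := key y hy
  rw [dist_comm] at this
  linarith

end Geometry

/-! ### Kernel integrability, power inequalities, averages -/

/-- In polar coordinates the exponent becomes `s + n - 1 > -1`. -/
lemma lintegral_ball_rpow_norm_lt_top {n : ℕ} (hn : 1 ≤ n) {s : ℝ} (hs : -(n : ℝ) < s) (c R : ℝ) :
    ∫⁻ z in ball (0 : EuclideanSpace ℝ (Fin n)) R, ENNReal.ofReal (c * ‖z‖ ^ s) < ∞ := by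
  have : Nonempty (Fin n) := ⟨⟨0, hn⟩⟩
  have hint : IntegrableOn (fun z : EuclideanSpace ℝ (Fin n) => c * ‖z‖ ^ s) (ball 0 R) := by
    rw [integrableOn_fun_norm_addHaar volume (f := fun t : ℝ => c * t ^ s)]
    rcases le_or_gt R 0 with hR | hR
    · simp [hR]
    have h1 : IntervalIntegrable (fun t : ℝ => t ^ (s + (n - 1 : ℕ))) volume 0 R :=
      intervalIntegral.intervalIntegrable_rpow' (by push_cast [hn]; linarith)
    rw [intervalIntegrable_iff_integrableOn_Ioo_of_le hR.le] at h1
    refine IntegrableOn.congr_fun (h1.const_mul c) (fun t ht => ?_) measurableSet_Ioo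
    simp only [finrank_euclideanSpace, Fintype.card_fin, smul_eq_mul]
    rw [Real.rpow_add_natCast ht.1.ne']
    ring
  exact hint.lintegral_lt_top

lemma rpow_le_of_le_two_mul_add {p a b s t D : ℝ} (hp : 1 ≤ p) (ha : 0 ≤ a) (hb : 0 ≤ b)
    (hs : 0 ≤ s) (ht : 0 ≤ t) (hD : 0 ≤ D) (h : D ≤ 2 * a + b * (s + t)) :
    D ^ p ≤ 6 ^ p * (a ^ p + b ^ p * (s ^ p + t ^ p)) := by
  have hp0 : 0 ≤ p := by linarith
  set m := max a (max (b * s) (b * t)) with hm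
  have h1 : D ≤ 6 * m := by
    have := le_max_left a (max (b * s) (b * t))
    have := (le_max_left (b * s) (b * t)).trans (le_max_right a _)
    have := (le_max_right (b * s) (b * t)).trans (le_max_right a _)
    rw [← hm] at *
    nlinarith
  have hm0 : 0 ≤ m := ha.trans (le_max_left _ _)
  calc D ^ p ≤ (6 * m) ^ p := Real.rpow_le_rpow hD h1 hp0
    _ = 6 ^ p * m ^ p := Real.mul_rpow (by norm_num) hm0
    _ ≤ _ := by
      gcongr
      have e1 := Real.rpow_nonneg ha p
      have e2 := mul_nonneg (Real.rpow_nonneg hb p) (Real.rpow_nonneg hs p)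
      have e3 := mul_nonneg (Real.rpow_nonneg hb p) (Real.rpow_nonneg ht p)
      rcases max_choice a (max (b * s) (b * t)) with h | h
      · rw [hm, h]; linarith
      rcases max_choice (b * s) (b * t) with h' | h'
      · rw [hm, h, h', Real.mul_rpow hb hs]; linarith
      · rw [hm, h, h', Real.mul_rpow hb ht]; linarith

/-- Subtracting the mean is, up to a factor `2`, the best approximation by a constant. -/
lemma eLpNorm_sub_average_le {α : Type*} [MeasurableSpace α] (μ : Measure α) [IsFiniteMeasure μ]
    [NeZero μ] {q : ℝ≥0∞} (hq : 1 ≤ q) {u : α → ℝ} (hu : AEStronglyMeasurable u μ)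
    (c : ℝ) :
    eLpNorm (fun x => u x - ⨍ y, u y ∂μ) q μ ≤ 2 * eLpNorm (fun x => u x - c) q μ := by
  have hv : AEStronglyMeasurable (fun x => u x - c) μ := hu.sub aestronglyMeasurable_const
  by_cases htop : eLpNorm (fun x => u x - c) q μ = ∞
  · simp [htop]
  have hvi : Integrable (fun x => u x - c) μ :=
    MemLp.integrable hq ⟨hv, lt_top_iff_ne_top.2 htop⟩
  have hui : Integrable u μ := by
    refine (hvi.add (integrable_const c)).congr (ae_of_all _ fun x => ?_)
    simp
  have hq0 : q ≠ 0 := (zero_lt_one.trans_le hq).ne'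
  have havg : c - ⨍ y, u y ∂μ = - ⨍ y, (u y - c) ∂μ := by
    have hne : μ.real univ ≠ 0 := by simp [measureReal_def, ENNReal.toReal_eq_zero_iff, NeZero.ne μ]
    rw [average_eq, average_eq, integral_sub hui (integrable_const c), integral_const]
    simp only [smul_eq_mul]
    field_simp
    ring
  -- Hölder applied to the average of `u - c`; the powers -1, 1 - 1/q and 1/q of the total mass
  -- cancel.
  have hconst : eLpNorm (fun _ : α => c - ⨍ y, u y ∂μ) q μ ≤ eLpNorm (fun x => u x - c) q μ := by
    rw [eLpNorm_const _ hq0 (NeZero.ne μ), havg, enorm_neg, average_eq, enorm_smul]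
    have h1 : ‖∫ y, (u y - c) ∂μ‖ₑ ≤
        eLpNorm (fun x => u x - c) q μ * μ univ ^ (1 - 1 / q.toReal) := by
      refine (enorm_integral_le_lintegral_enorm _).trans ?_
      have := eLpNorm_le_eLpNorm_mul_rpow_measure_univ hq hv
      rwa [eLpNorm_one_eq_lintegral_enorm, ENNReal.toReal_one, div_one] at this
    have hm0 : μ univ ≠ 0 := by simp [NeZero.ne μ]
    have hmt : μ univ ≠ ∞ := measure_ne_top μ univ
    have h2 : ‖(μ.real univ)⁻¹‖ₑ = (μ univ) ^ (-1 : ℝ) := by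
      rw [ENNReal.rpow_neg_one, Real.enorm_eq_ofReal (by positivity), ENNReal.ofReal_inv_of_pos,
        measureReal_def, ENNReal.ofReal_toReal hmt]
      exact ENNReal.toReal_pos hm0 hmt
    rw [h2]
    calc _ ≤ μ univ ^ (-1 : ℝ) * (eLpNorm (fun x => u x - c) q μ * μ univ ^ (1 - 1 / q.toReal))
          * μ univ ^ (1 / q.toReal) := by gcongr
      _ = eLpNorm (fun x => u x - c) q μ *
          (μ univ ^ (-1 : ℝ) * μ univ ^ (1 - 1 / q.toReal) * μ univ ^ (1 / q.toReal)) := by ring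
      _ = _ := by
        rw [← ENNReal.rpow_add _ _ hm0 hmt, ← ENNReal.rpow_add _ _ hm0 hmt,
          show (-1 : ℝ) + (1 - 1 / q.toReal) + 1 / q.toReal = 0 by ring, ENNReal.rpow_zero, mul_one]
  calc eLpNorm (fun x => u x - ⨍ y, u y ∂μ) q μ
      = eLpNorm ((fun x => u x - c) + fun _ => c - ⨍ y, u y ∂μ) q μ := by
        congr 1; ext x; simp
    _ ≤ _ := eLpNorm_add_le hv aestronglyMeasurable_const hq
    _ ≤ _ := by rw [two_mul]; gcongr


/-! ### Energy estimates -/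

section Energy

variable {n : ℕ} {Ω : Set (EuclideanSpace ℝ (Fin n))}

lemma measurable_indicator_of_continuousOn {u : EuclideanSpace ℝ (Fin n) → ℝ}
    {S : Set (EuclideanSpace ℝ (Fin n))} (hS : MeasurableSet S) (hu : ContinuousOn u S) :
    Measurable (S.indicator u) := by
  classical
  rw [← piecewise_eq_indicator]
  exact hu.measurable_piecewise (g := 0) continuousOn_const hS

lemma quotient_rpow_le {p κ a b s t D ρ : ℝ} (hp : 1 ≤ p) (ha : 0 ≤ a) (hb : 0 ≤ b)
    (hs : 0 ≤ s) (ht : 0 ≤ t) (hD : 0 ≤ D) (hρ : 0 < ρ) (h : D ≤ 2 * a + b * ρ * (s + t)) :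
    D ^ p / ρ ^ κ ≤ 6 ^ p * (a ^ p / ρ ^ κ + b ^ p * ρ ^ (p - κ) * (s ^ p + t ^ p)) := by
  have h1 := rpow_le_of_le_two_mul_add hp ha (mul_nonneg hb hρ.le) hs ht hD h
  rw [div_le_iff₀ (by positivity)]
  refine h1.trans (le_of_eq ?_)
  rw [Real.mul_rpow hb hρ.le, Real.rpow_sub hρ]
  have : ρ ^ κ ≠ 0 := by positivity
  field_simp

/-- The energy of `w` is controlled by that of `u` if the increments of `w` are controlled by those
of `u` up to a Lipschitz term weighted by `V`. -/
lemma lintegral_gFun_le (ho : IsOpen Ω) {g : EuclideanSpace ℝ (Fin n) → ℝ} {p δ τ L R : ℝ}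
    (hp : 1 ≤ p) (hL : 0 ≤ L) {u w V : EuclideanSpace ℝ (Fin n) → ℝ} (hV : Measurable V)
    (hV0 : ∀ x, 0 ≤ V x)
    (hw : ∀ x ∈ Ω, ∀ y ∈ Ω, |w x - w y| ≤ 2 * |u x - u y| + L * ‖x - y‖ * (V x + V y))
    (hR : ∀ x ∈ Ω, ∀ y ∈ Ω, ‖x - y‖ < R) {G : ℝ≥0∞}
    (hG₁ : ∀ x ∈ Ω, V x ≠ 0 → ENNReal.ofReal (g x) ≤ G)
    (hG₂ : ∀ x ∈ Ω, ∀ y ∈ Ω ∩ ball x (τ * infDist x (frontier Ω)), V y ≠ 0 →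
      ENNReal.ofReal (g x) ≤ G) :
    ∫⁻ x in Ω, gFun Ω p δ τ w x * ENNReal.ofReal (g x) ≤
      ENNReal.ofReal (6 ^ p) * ((∫⁻ x in Ω, gFun Ω p δ τ u x * ENNReal.ofReal (g x)) +
        2 * G * (∫⁻ z in ball (0 : EuclideanSpace ℝ (Fin n)) R,
          ENNReal.ofReal (L ^ p * ‖z‖ ^ (p - (n + p * δ)))) * ∫⁻ x, ENNReal.ofReal (V x ^ p)) := by
  set k : EuclideanSpace ℝ (Fin n) → ℝ≥0∞ := (ball 0 R).indicator
    fun z => ENNReal.ofReal (L ^ p * ‖z‖ ^ (p - (n + p * δ))) with hk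
  set W : EuclideanSpace ℝ (Fin n) → ℝ≥0∞ := fun x => ENNReal.ofReal (V x ^ p) with hW
  have hp0 : p ≠ 0 := by linarith
  have hkm : Measurable k := by
    refine Measurable.indicator ?_ measurableSet_ball
    fun_prop
  have hWm : Measurable W := by fun_prop
  have hW0 : ∀ x, W x ≠ 0 → V x ≠ 0 := fun x h h0 => h (by simp [hW, h0, hp0])
  have hkA : ∫⁻ z in ball (0 : EuclideanSpace ℝ (Fin n)) R,
      ENNReal.ofReal (L ^ p * ‖z‖ ^ (p - (n + p * δ))) = ∫⁻ z, k z :=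
    (lintegral_indicator measurableSet_ball _).symm
  rw [hkA]
  set A := ∫⁻ z, k z with hA
  have hpt : ∀ x ∈ Ω, ∀ y ∈ Ω,
      ENNReal.ofReal (|w x - w y| ^ p / ‖x - y‖ ^ ((n : ℝ) + p * δ)) ≤
      ENNReal.ofReal (6 ^ p) * (ENNReal.ofReal (|u x - u y| ^ p / ‖x - y‖ ^ ((n : ℝ) + p * δ))
        + (k (x - y) * W x + k (x - y) * W y)) := by
    intro x hx y hy
    rcases eq_or_ne x y with rfl | hxy
    · simp [hp0]
    have hρ : 0 < ‖x - y‖ := norm_pos_iff.2 (sub_ne_zero.2 hxy)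
    have hkv : k (x - y) = ENNReal.ofReal (L ^ p * ‖x - y‖ ^ (p - (n + p * δ))) := by
      rw [hk, indicator_of_mem]
      simpa using hR x hx y hy
    have h1 := Real.rpow_nonneg hL p
    have h2 := Real.rpow_nonneg (hV0 x) p
    have h3 := Real.rpow_nonneg (hV0 y) p
    have h4 : 0 ≤ ‖x - y‖ ^ (p - (n + p * δ)) := by positivity
    rw [← mul_add, hkv, hW, ← ENNReal.ofReal_add h2 h3, ← ENNReal.ofReal_mul (by positivity),
      ← ENNReal.ofReal_add (by positivity) (by positivity), ← ENNReal.ofReal_mul (by positivity)]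
    exact ENNReal.ofReal_le_ofReal (quotient_rpow_le hp (abs_nonneg _) hL (hV0 x) (hV0 y)
      (abs_nonneg _) hρ (hw x hx y hy))
  have hgF : ∀ x ∈ Ω, gFun Ω p δ τ w x * ENNReal.ofReal (g x) ≤
      ENNReal.ofReal (6 ^ p) * (gFun Ω p δ τ u x * ENNReal.ofReal (g x) +
        (G * A * W x + G * ∫⁻ y, k (x - y) * W y)) := by
    intro x hx
    have hkx : Measurable fun y => k (x - y) := hkm.comp (measurable_const.sub measurable_id)
    have hkWx : Measurable fun y => k (x - y) * W y := hkx.mul hWm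
    have hkW' : Measurable fun y => k (x - y) * W x + k (x - y) * W y := (hkx.mul_const _).add hkWx
    have hms : MeasurableSet (Ω ∩ ball x (τ * infDist x (frontier Ω))) :=
      ho.measurableSet.inter measurableSet_ball
    have hA' : ∫⁻ y, k (x - y) = A := lintegral_sub_left_eq_self k x
    have e1 : gFun Ω p δ τ w x ≤ ENNReal.ofReal (6 ^ p) * (gFun Ω p δ τ u x +
        ((∫⁻ y in Ω ∩ ball x (τ * infDist x (frontier Ω)), k (x - y) * W x) +
          ∫⁻ y in Ω ∩ ball x (τ * infDist x (frontier Ω)), k (x - y) * W y)) := by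
      unfold gFun
      -- Neither `u` nor its energy density is assumed measurable, so integrals are split along the
      -- measurable kernel terms only.
      rw [← lintegral_add_left (hkx.mul_const _),
        ← lintegral_add_right _ hkW',
        ← lintegral_const_mul' _ _ ENNReal.ofReal_ne_top]
      exact setLIntegral_mono' hms fun y hy => hpt x hx y hy.1
    have e2 : (∫⁻ y in Ω ∩ ball x (τ * infDist x (frontier Ω)), k (x - y) * W x)
        * ENNReal.ofReal (g x) ≤ G * A * W x := by
      by_cases h0 : W x = 0
      · simp [h0]
      rw [lintegral_mul_const _ hkx]
      calc _ ≤ A * W x * G := by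
            gcongr
            · exact (setLIntegral_le_lintegral _ _).trans hA'.le
            · exact hG₁ x hx (hW0 x h0)
        _ = _ := by ring
    have e3 : (∫⁻ y in Ω ∩ ball x (τ * infDist x (frontier Ω)), k (x - y) * W y)
        * ENNReal.ofReal (g x) ≤ G * ∫⁻ y, k (x - y) * W y := by
      rw [← lintegral_mul_const' _ _ ENNReal.ofReal_ne_top, ← lintegral_const_mul _ hkWx]
      refine (setLIntegral_mono' hms fun y hy => ?_).trans (setLIntegral_le_lintegral _ _)
      by_cases h0 : W y = 0
      · simp [h0]
      rw [mul_comm G]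
      gcongr
      exact hG₂ x hx y hy (hW0 y h0)
    calc _ ≤ _ := mul_le_mul_left e1 _
      _ = ENNReal.ofReal (6 ^ p) * (gFun Ω p δ τ u x * ENNReal.ofReal (g x) +
          ((∫⁻ y in Ω ∩ ball x (τ * infDist x (frontier Ω)), k (x - y) * W x)
            * ENNReal.ofReal (g x) +
          (∫⁻ y in Ω ∩ ball x (τ * infDist x (frontier Ω)), k (x - y) * W y)
            * ENNReal.ofReal (g x))) := by ring
      _ ≤ _ := by gcongr
  have hkW : Measurable (Function.uncurry fun x y => k (x - y) * W y) :=
    (hkm.comp measurable_sub).mul (hWm.comp measurable_snd)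
  have hTm : Measurable fun x => ∫⁻ y, k (x - y) * W y := hkW.lintegral_prod_right
  -- Tonelli and translation invariance: convolution with `k` multiplies the total integral by `A`.
  have hT : ∫⁻ x, ∫⁻ y, k (x - y) * W y = A * ∫⁻ y, W y := by
    rw [lintegral_lintegral_swap hkW.aemeasurable, ← lintegral_const_mul _ hWm]
    refine lintegral_congr fun y => ?_
    have hky : Measurable fun x => k (x - y) := hkm.comp (measurable_id.sub measurable_const)
    rw [lintegral_mul_const _ hky,
      lintegral_sub_right_eq_self k y]
  have hsum : Measurable fun x => G * A * W x + G * ∫⁻ y, k (x - y) * W y :=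
    (hWm.const_mul _).add (hTm.const_mul _)
  calc _ ≤ _ := setLIntegral_mono' ho.measurableSet hgF
    _ = ENNReal.ofReal (6 ^ p) * ((∫⁻ x in Ω, gFun Ω p δ τ u x * ENNReal.ofReal (g x)) +
        (G * A * (∫⁻ x in Ω, W x) + G * ∫⁻ x in Ω, ∫⁻ y, k (x - y) * W y)) := by
      rw [lintegral_const_mul' _ _ ENNReal.ofReal_ne_top,
        lintegral_add_right _ hsum,
        lintegral_add_right _ (hTm.const_mul _), lintegral_const_mul _ hWm,
        lintegral_const_mul _ hTm]
    _ ≤ ENNReal.ofReal (6 ^ p) * ((∫⁻ x in Ω, gFun Ω p δ τ u x * ENNReal.ofReal (g x)) +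
        (G * A * (∫⁻ x, W x) + G * (A * ∫⁻ x, W x))) := by
      rw [← hT]
      gcongr <;> exact Measure.restrict_le_self
    _ = _ := by ring

/-- A local fractional Poincaré inequality on a set so small that all its pairs of points interact;
the constant is the value of `u` at a suitable point. -/
lemma exists_lintegral_sub_rpow_le (ho : IsOpen Ω) {g : EuclideanSpace ℝ (Fin n) → ℝ}
    {p δ τ m M : ℝ} (hp : 0 < p) {u : EuclideanSpace ℝ (Fin n) → ℝ} (hu : ContinuousOn u Ω)
    {S : Set (EuclideanSpace ℝ (Fin n))} (hS : MeasurableSet S) (hSΩ : S ⊆ Ω)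
    (hS0 : volume S ≠ 0) (hSt : volume S ≠ ∞)
    (hSτ : ∀ x ∈ S, ∀ y ∈ S, dist y x < τ * infDist x (frontier Ω))
    (hm : 0 < m) (hmg : ∀ x ∈ S, m ≤ g x)
    (hM : ∀ x ∈ S, ∀ y ∈ S, ‖x - y‖ ^ ((n : ℝ) + p * δ) ≤ M) :
    ∃ z ∈ S, ∫⁻ y in S, ENNReal.ofReal (|u y - u z| ^ p) ≤
      ENNReal.ofReal (M / m) / volume S *
        ∫⁻ x in Ω, gFun Ω p δ τ u x * ENNReal.ofReal (g x) := by
  set v := Ω.indicator u with hv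
  have hvm : Measurable v := measurable_indicator_of_continuousOn ho.measurableSet hu
  have hvu : ∀ x ∈ S, v x = u x := fun x hx => indicator_of_mem (hSΩ hx) u
  have hFm : Measurable fun x => ∫⁻ y in S, ENNReal.ofReal (|v y - v x| ^ p) := by
    refine Measurable.lintegral_prod_right
      (f := fun x y => ENNReal.ofReal (|v y - v x| ^ p)) ?_
    have h1 : Measurable fun z : EuclideanSpace ℝ (Fin n) × EuclideanSpace ℝ (Fin n) =>
      |v z.2 - v z.1| := (continuous_abs.measurable).comp
        ((hvm.comp measurable_snd).sub (hvm.comp measurable_fst))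
    exact (h1.pow_const p).ennreal_ofReal
  -- Some `z` does no worse than the mean over `S`, which leaves a double integral over `S × S` to
  -- compare with the energy.
  obtain ⟨z, hz, hzle⟩ := exists_le_setLAverage (μ := volume) hS0 hSt hFm.aemeasurable
  refine ⟨z, hz, ?_⟩
  have e1 : ∫⁻ y in S, ENNReal.ofReal (|u y - u z| ^ p)
      = ∫⁻ y in S, ENNReal.ofReal (|v y - v z| ^ p) :=
    setLIntegral_congr_fun hS fun y hy => by simp only [hvu y hy, hvu z hz]
  rw [e1]
  refine hzle.trans ?_
  rw [setLAverage_eq, ENNReal.div_eq_inv_mul, ENNReal.div_eq_inv_mul, mul_assoc]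
  gcongr
  rw [← lintegral_const_mul' _ _ ENNReal.ofReal_ne_top]
  refine le_trans ?_ (lintegral_mono_set hSΩ)
  refine setLIntegral_mono' hS fun x hx => ?_
  have hM0 : 0 ≤ M := (by positivity : 0 ≤ ‖x - x‖ ^ ((n : ℝ) + p * δ)).trans (hM x hx x hx)
  have e2 : ∫⁻ y in S, ENNReal.ofReal (|v y - v x| ^ p) ≤
      ENNReal.ofReal M * gFun Ω p δ τ u x := by
    unfold gFun
    rw [← lintegral_const_mul' _ _ ENNReal.ofReal_ne_top]
    have hsub : S ⊆ Ω ∩ ball x (τ * infDist x (frontier Ω)) :=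
      fun y hy => ⟨hSΩ hy, hSτ x hx y hy⟩
    refine le_trans ?_ (lintegral_mono_set hsub)
    refine setLIntegral_mono' hS fun y hy => ?_
    rw [hvu y hy, hvu x hx, ← ENNReal.ofReal_mul hM0]
    refine ENNReal.ofReal_le_ofReal ?_
    rcases eq_or_ne x y with rfl | hxy
    · simp [hp.ne']
    have hρ : 0 < ‖x - y‖ := norm_pos_iff.2 (sub_ne_zero.2 hxy)
    rw [← mul_div_assoc, le_div_iff₀ (by positivity), abs_sub_comm, mul_comm M]
    gcongr
    exact hM x hx y hy
  calc _ ≤ _ := e2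
    _ = ENNReal.ofReal (M / m) * (gFun Ω p δ τ u x * ENNReal.ofReal m) := by
      rw [mul_left_comm, ← ENNReal.ofReal_mul (by positivity), div_mul_cancel₀ _ hm.ne', mul_comm]
    _ ≤ _ := by gcongr; exact hmg x hx

end Energy


/-! ### Energy of a truncated function -/

section Cutoff

variable {n : ℕ} {Ω : Set (EuclideanSpace ℝ (Fin n))}

/-- The piecewise linear cutoff that is `1` on `ball x₀ r` and `0` outside `ball x₀ (2 * r)`. -/
def cutoff (x₀ : EuclideanSpace ℝ (Fin n)) (r : ℝ) (x : EuclideanSpace ℝ (Fin n)) : ℝ :=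
  max 0 (min 1 (2 - dist x x₀ / r))

lemma continuous_cutoff (x₀ : EuclideanSpace ℝ (Fin n)) (r : ℝ) : Continuous (cutoff x₀ r) := by
  unfold cutoff
  fun_prop

lemma cutoff_nonneg (x₀ : EuclideanSpace ℝ (Fin n)) (r : ℝ) (x : EuclideanSpace ℝ (Fin n)) :
    0 ≤ cutoff x₀ r x := le_max_left _ _

lemma cutoff_le_one (x₀ : EuclideanSpace ℝ (Fin n)) (r : ℝ) (x : EuclideanSpace ℝ (Fin n)) :
    cutoff x₀ r x ≤ 1 := max_le zero_le_one (min_le_left _ _)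

lemma cutoff_eq_one {x₀ : EuclideanSpace ℝ (Fin n)} {r : ℝ} (hr : 0 < r)
    {x : EuclideanSpace ℝ (Fin n)} (hx : x ∈ ball x₀ r) : cutoff x₀ r x = 1 := by
  have : dist x x₀ / r ≤ 1 := (div_le_one hr).2 (mem_ball.1 hx).le
  rw [cutoff, min_eq_left (by linarith), max_eq_right zero_le_one]

lemma cutoff_eq_zero {x₀ : EuclideanSpace ℝ (Fin n)} {r : ℝ} (hr : 0 < r)
    {x : EuclideanSpace ℝ (Fin n)} (hx : x ∉ ball x₀ (2 * r)) : cutoff x₀ r x = 0 := by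
  rw [mem_ball, not_lt] at hx
  have : 2 ≤ dist x x₀ / r := (le_div_iff₀ hr).2 hx
  exact max_eq_left ((min_le_right _ _).trans (by linarith))

lemma abs_cutoff_sub_le {x₀ : EuclideanSpace ℝ (Fin n)} {r : ℝ} (hr : 0 < r)
    (x y : EuclideanSpace ℝ (Fin n)) : |cutoff x₀ r x - cutoff x₀ r y| ≤ r⁻¹ * ‖x - y‖ := by
  have h : |dist x x₀ - dist y x₀| ≤ ‖x - y‖ := by
    rw [← dist_eq_norm]; exact abs_dist_sub_le x y x₀
  calc |cutoff x₀ r x - cutoff x₀ r y|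
      ≤ |min 1 (2 - dist x x₀ / r) - min 1 (2 - dist y x₀ / r)| := by
        simpa [cutoff] using
          abs_max_sub_max_le_max 0 (min 1 (2 - dist x x₀ / r)) 0 (min 1 (2 - dist y x₀ / r))
    _ ≤ |(2 - dist x x₀ / r) - (2 - dist y x₀ / r)| := by
        simpa using abs_min_sub_min_le_max 1 (2 - dist x x₀ / r) 1 (2 - dist y x₀ / r)
    _ = r⁻¹ * |dist x x₀ - dist y x₀| := by
        rw [abs_sub_comm, ← abs_of_pos (inv_pos.2 hr), ← abs_mul,
          inv_mul_eq_div, sub_div, sub_sub_sub_cancel_left]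
    _ ≤ _ := by gcongr

/-- Product rule for increments. Tying `s` and `t` to `|v|` and `|w|` only where the cutoff is
nonzero allows them to be truncated to its support. -/
lemma abs_mul_sub_mul_le {a b v w s t : ℝ} (hb0 : 0 ≤ b) (hb1 : b ≤ 1)
    (hs : 0 ≤ s) (ht : 0 ≤ t) (ha : a ≠ 0 → s = |v|) (hb : b ≠ 0 → t = |w|) :
    |a * v - b * w| ≤ |v - w| + |a - b| * (s + t) := by
  have h1 := abs_nonneg (v - w)
  have h2 := abs_nonneg (a - b)
  by_cases h : a = 0
  · by_cases h' : b = 0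
    · simp only [h, h', zero_mul, sub_zero, abs_zero, add_zero]
      exact h1
    · have h3 : |a * v - b * w| = b * t := by
        rw [h, zero_mul, zero_sub, abs_neg, abs_mul, ← hb h', abs_of_nonneg hb0]
      have h4 : |a - b| = b := by rw [h, zero_sub, abs_neg, abs_of_nonneg hb0]
      rw [h3, h4]
      nlinarith
  · calc |a * v - b * w| = |b * (v - w) + (a - b) * v| := by congr 1; ring
      _ ≤ |b * (v - w)| + |(a - b) * v| := abs_add_le _ _
      _ = b * |v - w| + |a - b| * s := by rw [abs_mul, abs_mul, abs_of_nonneg hb0, ha h]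
      _ ≤ _ := by nlinarith

/-- Multiplying `u - c`, for a suitable constant `c`, by a cutoff supported in a tiny ball (or by
its complement) increases the energy by at most a constant factor. -/
lemma exists_lintegral_gFun_cutoff_le (hn : 1 ≤ n) (ho : IsOpen Ω) (hb : Bornology.IsBounded Ω)
    {x₀ : EuclideanSpace ℝ (Fin n)} (hx₀ : x₀ ∈ Ω) {g : EuclideanSpace ℝ (Fin n) → ℝ}
    (hg : ContinuousOn g Ω) (hg0 : ∀ x ∈ Ω, 0 < g x) {p δ τ r : ℝ} (hp : 1 ≤ p) (hδ0 : 0 < δ)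
    (hδ1 : δ < 1) (hτ0 : 0 < τ) (hτ1 : τ < 1 / 2) (hr : r = τ * infDist x₀ (frontier Ω) / 16) :
    ∃ K : ℝ≥0, ∀ u : EuclideanSpace ℝ (Fin n) → ℝ, ContinuousOn u Ω → ∃ c : ℝ,
      (∫⁻ x in Ω, gFun Ω p δ τ (fun x => cutoff x₀ r x * (u x - c)) x * ENNReal.ofReal (g x) ≤
        K * ∫⁻ x in Ω, gFun Ω p δ τ u x * ENNReal.ofReal (g x)) ∧
      ∫⁻ x in Ω, gFun Ω p δ τ (fun x => (1 - cutoff x₀ r x) * (u x - c)) x *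
        ENNReal.ofReal (g x) ≤ K * ∫⁻ x in Ω, gFun Ω p δ τ u x * ENNReal.ofReal (g x) := by
  have hd := infDist_frontier_pos hn ho hb hx₀
  set d := infDist x₀ (frontier Ω) with hd_def
  have hr0 : 0 < r := by rw [hr]; positivity
  have hrd : r < d / 32 := by rw [hr]; nlinarith
  set S := ball x₀ (2 * r) with hS
  have hSm : MeasurableSet S := measurableSet_ball
  have hSΩ : S ⊆ Ω := (ball_subset_ball (by linarith)).trans (ball_infDist_frontier_subset ho hx₀)
  have hSd : ∀ x ∈ S, d * (15 / 16) ≤ infDist x (frontier Ω) := fun x hx => by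
    have h1 := infDist_le_infDist_add_dist (s := frontier Ω) (x := x₀) (y := x)
    rw [hS, mem_ball, dist_comm] at hx
    linarith
  have hK := isCompact_inter_infDist_frontier ho hb (c := d / 4) (by positivity)
  set K := {x ∈ Ω | d / 4 ≤ infDist x (frontier Ω)} with hKdef
  have hKΩ : K ⊆ Ω := fun x hx => hx.1
  have hSK : S ⊆ K := fun x hx => ⟨hSΩ hx, by linarith [hSd x hx]⟩
  obtain ⟨G, hG⟩ := hK.exists_bound_of_continuousOn (hg.mono hKΩ)
  obtain ⟨xm, hxm, hmin⟩ := hK.exists_isMinOn ⟨x₀, hx₀, by linarith⟩ (hg.mono hKΩ)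
  obtain ⟨R', hR'⟩ := isBounded_iff.1 hb
  set R := R' + 1 with hRdef
  have hR : ∀ x ∈ Ω, ∀ y ∈ Ω, ‖x - y‖ < R := fun x hx y hy => by
    have := hR' hx hy
    rw [dist_eq_norm] at this
    linarith
  have hκ : 0 ≤ (n : ℝ) + p * δ := by positivity
  -- The exponent exceeds `-n` because `p * (1 - δ) > 0`.
  have hA := lintegral_ball_rpow_norm_lt_top hn (s := p - (n + p * δ)) (by nlinarith) (r⁻¹ ^ p) R
  set A := ∫⁻ z in ball (0 : EuclideanSpace ℝ (Fin n)) R,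
    ENNReal.ofReal (r⁻¹ ^ p * ‖z‖ ^ (p - (n + p * δ)))
  have hS0 : volume S ≠ 0 := (measure_ball_pos volume x₀ (by linarith)).ne'
  have hSt : volume S ≠ ∞ := measure_ball_lt_top.ne
  set P := ENNReal.ofReal (R ^ ((n : ℝ) + p * δ) / g xm) / volume S with hP
  have hPt : P ≠ ∞ := ENNReal.div_ne_top ENNReal.ofReal_ne_top hS0
  set T := ENNReal.ofReal (6 ^ p) * (1 + 2 * ENNReal.ofReal G * A * P) with hT
  have hTt : T ≠ ∞ := by
    rw [hT]
    finiteness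
  refine ⟨T.toNNReal, fun u hu => ?_⟩
  rw [ENNReal.coe_toNNReal hTt]
  obtain ⟨z, -, hz⟩ := exists_lintegral_sub_rpow_le ho (δ := δ) (τ := τ) (m := g xm) (g := g)
    (M := R ^ ((n : ℝ) + p * δ)) (by linarith : 0 < p) hu hSm hSΩ hS0 hSt
    -- The diameter bound `4 * r = τ * d / 4` is below `τ * (15 / 16) * d`, so all pairs in `S`
    -- interact.
    (fun x hx y hy => by
      have h1 := dist_triangle_right y x x₀
      have h2 := hSd x hx
      rw [hS, mem_ball] at hx hy
      nlinarith)
    (hg0 _ hxm.1) (fun x hx => hmin (hSK hx))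
    (fun x hx y hy => Real.rpow_le_rpow (norm_nonneg _) (hR x (hSΩ hx) y (hSΩ hy)).le hκ)
  refine ⟨u z, ?_⟩
  set V := S.indicator fun x => |u x - u z| with hV
  have hVm : Measurable V := measurable_indicator_of_continuousOn hSm
    ((hu.mono hSΩ).sub continuousOn_const).abs
  have hV0 : ∀ x, 0 ≤ V x := fun x => indicator_nonneg (fun _ _ => abs_nonneg _) x
  have hVS : ∀ x, V x ≠ 0 → x ∈ S := fun x h => by
    by_contra hx
    exact h (indicator_of_notMem hx _)
  have hVint : ∫⁻ x, ENNReal.ofReal (V x ^ p) = ∫⁻ y in S, ENNReal.ofReal (|u y - u z| ^ p) := by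
    rw [← lintegral_indicator hSm]
    refine lintegral_congr fun x => ?_
    by_cases hx : x ∈ S
    · simp only [hV, indicator_of_mem hx]
    · simp only [hV, indicator_of_notMem hx]
      rw [Real.zero_rpow (by linarith), ENNReal.ofReal_zero]
  have hinc : ∀ x y, |cutoff x₀ r x * (u x - u z) - cutoff x₀ r y * (u y - u z)| ≤
      |u x - u y| + r⁻¹ * ‖x - y‖ * (V x + V y) := fun x y => by
    have hφ : ∀ x, cutoff x₀ r x ≠ 0 → V x = |u x - u z| := fun x hx =>
      indicator_of_mem (by_contra fun h => hx (cutoff_eq_zero hr0 h)) _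
    have h1 := abs_mul_sub_mul_le (cutoff_nonneg x₀ r y)
      (cutoff_le_one x₀ r y) (hV0 x) (hV0 y) (hφ x) (hφ y)
    rw [sub_sub_sub_cancel_right] at h1
    refine h1.trans ?_
    gcongr
    · exact add_nonneg (hV0 x) (hV0 y)
    · exact abs_cutoff_sub_le hr0 x y
  have key : ∀ w : EuclideanSpace ℝ (Fin n) → ℝ, (∀ x ∈ Ω, ∀ y ∈ Ω,
      |w x - w y| ≤ 2 * |u x - u y| + r⁻¹ * ‖x - y‖ * (V x + V y)) →
      ∫⁻ x in Ω, gFun Ω p δ τ w x * ENNReal.ofReal (g x) ≤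
        T * ∫⁻ x in Ω, gFun Ω p δ τ u x * ENNReal.ofReal (g x) := by
    intro w hw
    have hGK : ∀ x ∈ K, ENNReal.ofReal (g x) ≤ ENNReal.ofReal G := fun x hx =>
      ENNReal.ofReal_le_ofReal ((le_abs_self _).trans (hG x hx))
    refine (lintegral_gFun_le ho hp (inv_nonneg.2 hr0.le) hVm hV0 hw hR
      (G := ENNReal.ofReal G) (fun x _ h => hGK x (hSK (hVS x h))) ?_).trans ?_
    -- If `x` interacts with `y ∈ S`, then `infDist x ≥ (15 / 16) * d - infDist x / 2` because `τ <
    -- 1 / 2`; hence `x ∈ K`.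
    · intro x hx y hy h
      refine hGK x ⟨hx, ?_⟩
      have h1 := hSd y (hVS y h)
      have h2 := infDist_le_infDist_add_dist (s := frontier Ω) (x := y) (y := x)
      have h3 := mem_ball.1 hy.2
      have h4 := infDist_nonneg (x := x) (s := frontier Ω)
      nlinarith
    · rw [hVint, hT]
      calc _ ≤ ENNReal.ofReal (6 ^ p) * ((∫⁻ x in Ω, gFun Ω p δ τ u x * ENNReal.ofReal (g x)) +
            2 * ENNReal.ofReal G * A *
              (P * ∫⁻ x in Ω, gFun Ω p δ τ u x * ENNReal.ofReal (g x))) := by gcongr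
        _ = _ := by ring
  refine ⟨key _ fun x _ y _ => (hinc x y).trans ?_, key _ fun x _ y _ => ?_⟩
  · linarith [abs_nonneg (u x - u y)]
  -- The complementary cutoff costs one more increment of `u`, hence the factor 2 in `key`.
  · have h1 : (1 - cutoff x₀ r x) * (u x - u z) - (1 - cutoff x₀ r y) * (u y - u z) =
        (u x - u y) - (cutoff x₀ r x * (u x - u z) - cutoff x₀ r y * (u y - u z)) := by ring
    rw [h1]
    linarith [abs_sub (u x - u y) (cutoff x₀ r x * (u x - u z) - cutoff x₀ r y * (u y - u z)),
      hinc x y]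

end Cutoff

/-! ### The weighted measure -/

section Weight

variable {n : ℕ} {Ω : Set (EuclideanSpace ℝ (Fin n))}

/-- The measure `f dx` on `Ω`. -/
def weightedMeasure (Ω : Set (EuclideanSpace ℝ (Fin n))) (f : EuclideanSpace ℝ (Fin n) → ℝ) :
    Measure (EuclideanSpace ℝ (Fin n)) :=
  (volume.restrict Ω).withDensity fun x => ENNReal.ofReal (f x)

lemma weightedNorm_eq_eLpNorm (ho : IsOpen Ω) {f : EuclideanSpace ℝ (Fin n) → ℝ}
    (hf : ContinuousOn f Ω) {q : ℝ} (hq : 0 < q) (u : EuclideanSpace ℝ (Fin n) → ℝ) :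
    weightedNorm Ω f q u = eLpNorm u (ENNReal.ofReal q) (weightedMeasure Ω f) := by
  have hfm := (hf.aemeasurable (μ := volume) ho.measurableSet).ennreal_ofReal
  rw [eLpNorm_eq_lintegral_rpow_enorm_toReal (by simpa using hq) ENNReal.ofReal_ne_top,
    ENNReal.toReal_ofReal hq.le, weightedMeasure,
    lintegral_withDensity_eq_lintegral_mul_non_measurable₀ _ hfm (by simp), weightedNorm]
  congr 1
  refine lintegral_congr fun x => ?_
  rw [Pi.mul_apply, mul_comm, ENNReal.ofReal_mul' (by positivity), Real.enorm_eq_ofReal_abs,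
    ENNReal.ofReal_rpow_of_nonneg (abs_nonneg _) hq.le]

lemma weightedMeasure_univ_eq (f : EuclideanSpace ℝ (Fin n) → ℝ) :
    weightedMeasure Ω f univ = ∫⁻ x in Ω, ENNReal.ofReal (f x) := by
  rw [weightedMeasure, withDensity_apply _ MeasurableSet.univ, Measure.restrict_univ]

lemma average_weightedMeasure (ho : IsOpen Ω) {f : EuclideanSpace ℝ (Fin n) → ℝ}
    (hf : ContinuousOn f Ω) (hf0 : ∀ x ∈ Ω, 0 < f x) (u : EuclideanSpace ℝ (Fin n) → ℝ) :
    ⨍ x, u x ∂(weightedMeasure Ω f) = weightedAverage Ω f u := by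
  have hfm := hf.aemeasurable (μ := volume) ho.measurableSet
  rw [average_eq, weightedAverage, smul_eq_mul, div_eq_inv_mul, measureReal_def,
    weightedMeasure_univ_eq, integral_eq_lintegral_of_nonneg_ae
      (ae_restrict_of_forall_mem ho.measurableSet fun x hx => (hf0 x hx).le)
      hfm.aestronglyMeasurable]
  congr 1
  rw [weightedMeasure, integral_withDensity_eq_integral_toReal_smul₀ hfm.ennreal_ofReal (by simp)]
  refine setIntegral_congr_fun ho.measurableSet fun x hx => ?_
  simp only [ENNReal.toReal_ofReal (hf0 x hx).le, smul_eq_mul]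
  ring

lemma integrable_weightedMeasure_iff (ho : IsOpen Ω) {f : EuclideanSpace ℝ (Fin n) → ℝ}
    (hf : ContinuousOn f Ω) (hf0 : ∀ x ∈ Ω, 0 < f x) (u : EuclideanSpace ℝ (Fin n) → ℝ) :
    Integrable u (weightedMeasure Ω f) ↔ IntegrableOn (fun x => u x * f x) Ω := by
  have hfm := hf.aemeasurable (μ := volume) ho.measurableSet
  rw [weightedMeasure, integrable_withDensity_iff_integrable_smul₀' hfm.ennreal_ofReal (by simp)]
  refine integrableOn_congr_fun (fun x hx => ?_) ho.measurableSet
  simp only [ENNReal.toReal_ofReal (hf0 x hx).le, smul_eq_mul]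
  ring

end Weight

end WeightedFractional

end

/-! ### The main theorem -/

open WeightedFractional in
theorem theorem3p2 (n : ℕ) (hn : 2 ≤ n) (Ω : Set (EuclideanSpace ℝ (Fin n)))
    (hΩo : IsOpen Ω) (hΩb : Bornology.IsBounded Ω) :
    ∃ τ₀ : ℝ, 0 < τ₀ ∧
      ∀ f g : EuclideanSpace ℝ (Fin n) → ℝ,
        ContinuousOn f Ω → ContinuousOn g Ω →
        (∀ x ∈ Ω, 0 < f x) → (∀ x ∈ Ω, 0 < g x) →
        IntegrableOn f Ω →
      ∀ p q δ : ℝ, 1 ≤ p → p ≤ q → 0 < δ → δ < 1 →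
      ∀ τ : ℝ, 0 < τ → τ < τ₀ →
        (∀ (x₀ : EuclideanSpace ℝ (Fin n)) (r : ℝ), 0 < r →
          WeightedFractional.CompactlyInside (Metric.ball x₀ r) Ω →
          ∃ C : ℝ≥0, ∀ u : EuclideanSpace ℝ (Fin n) → ℝ, ContinuousOn u Ω →
            (∀ x ∈ Metric.ball x₀ r, u x = 0) →
            WeightedFractional.weightedNorm Ω f q u
              ≤ C * WeightedFractional.fracSeminorm Ω g p δ τ u) →
        ∃ C : ℝ≥0, ∀ u : EuclideanSpace ℝ (Fin n) → ℝ, ContinuousOn u Ω →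
          (WeightedFractional.fracSeminorm Ω g p δ τ u < ∞ →
            IntegrableOn (fun x => u x * f x) Ω) ∧
          WeightedFractional.weightedNorm Ω f q
              (fun x => u x - WeightedFractional.weightedAverage Ω f u)
            ≤ C * WeightedFractional.fracSeminorm Ω g p δ τ u := by
  refine ⟨1 / 2, by norm_num, ?_⟩
  intro f g hf hg hf0 hg0 hfi p q δ hp hpq hδ0 hδ1 τ hτ0 hτ1 hyp
  have hq0 : 0 < q := by linarith
  rcases Ω.eq_empty_or_nonempty with rfl | ⟨x₀, hx₀⟩
  · refine ⟨0, fun u _ => ⟨fun _ => by simp, ?_⟩⟩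
    simp [weightedNorm, hq0]
  have hd := infDist_frontier_pos (by linarith) hΩo hΩb hx₀
  set r := τ * infDist x₀ (frontier Ω) / 16 with hr
  have hr0 : 0 < r := by positivity
  have hrd : r < infDist x₀ (frontier Ω) / 32 := by rw [hr]; nlinarith
  obtain ⟨K, hK⟩ := exists_lintegral_gFun_cutoff_le (by linarith) hΩo hΩb hx₀ hg hg0 hp hδ0 hδ1
    hτ0 hτ1 hr
  -- At distance `4 * r`, `ball x₂ r` misses the support of the cutoff, and `5 * r` is still less
  -- than the distance from `x₀` to the boundary.
  set x₂ := x₀ + (4 * r) • EuclideanSpace.single (⟨0, by linarith⟩ : Fin n) (1 : ℝ) with hx₂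
  have hx₂d : dist x₂ x₀ = 4 * r := by
    rw [hx₂, dist_eq_norm, add_sub_cancel_left, norm_smul, PiLp.norm_single, norm_one,
      mul_one, Real.norm_of_nonneg (by positivity)]
  obtain ⟨C₁, hC₁⟩ := hyp x₀ r hr0 (compactlyInside_ball hΩo hx₀ (by rw [dist_self]; linarith))
  obtain ⟨C₂, hC₂⟩ := hyp x₂ r hr0 (compactlyInside_ball hΩo hx₀ (by rw [hx₂d]; linarith))
  set μ := weightedMeasure Ω f with hμ
  have hμt : μ univ < ∞ := by
    rw [hμ, weightedMeasure_univ_eq]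
    exact hfi.lintegral_lt_top
  have hμ0 : μ univ ≠ 0 := by
    rw [hμ, weightedMeasure_univ_eq, Ne, setLIntegral_eq_zero_iff' hΩo.measurableSet
      (hf.aemeasurable hΩo.measurableSet).ennreal_ofReal]
    intro h
    refine (hΩo.measure_pos volume ⟨x₀, hx₀⟩).ne' (measure_eq_zero_iff_ae_notMem.2 ?_)
    filter_upwards [h] with x hx hxΩ
    exact (hf0 x hxΩ).not_ge (ENNReal.ofReal_eq_zero.1 (hx hxΩ))
  have : IsFiniteMeasure μ := ⟨hμt⟩
  have : NeZero μ := ⟨fun h => hμ0 (by simp [h])⟩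
  have haesm : ∀ w : EuclideanSpace ℝ (Fin n) → ℝ, ContinuousOn w Ω → AEStronglyMeasurable w μ :=
    fun w hw => (hw.aestronglyMeasurable hΩo.measurableSet).mono_ac
      (withDensity_absolutelyContinuous _ _)
  have hq1 : 1 ≤ ENNReal.ofReal q := by rw [ENNReal.one_le_ofReal]; linarith
  have hp0 : 0 ≤ 1 / p := by positivity
  have hmain : ∀ u : EuclideanSpace ℝ (Fin n) → ℝ, ContinuousOn u Ω → ∃ c : ℝ,
      eLpNorm (fun x => u x - c) (ENNReal.ofReal q) μ ≤
        (C₁ + C₂) * (K : ℝ≥0∞) ^ (1 / p) * fracSeminorm Ω g p δ τ u := by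
    intro u hu
    obtain ⟨c, h₁, h₂⟩ := hK u hu
    refine ⟨c, ?_⟩
    have huc : ContinuousOn (fun x => u x - c) Ω := hu.sub continuousOn_const
    have hφ := (continuous_cutoff x₀ r).continuousOn (s := Ω)
    have hw₁ := hφ.mul huc
    have hw₂ := (continuousOn_const (c := (1 : ℝ)).sub hφ).mul huc
    have hE : ∀ w : EuclideanSpace ℝ (Fin n) → ℝ,
        ∫⁻ x in Ω, gFun Ω p δ τ w x * ENNReal.ofReal (g x) ≤
          K * ∫⁻ x in Ω, gFun Ω p δ τ u x * ENNReal.ofReal (g x) →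
        fracSeminorm Ω g p δ τ w ≤ (K : ℝ≥0∞) ^ (1 / p) * fracSeminorm Ω g p δ τ u := by
      intro w hw
      rw [fracSeminorm, fracSeminorm, ← ENNReal.mul_rpow_of_nonneg _ _ hp0]
      exact ENNReal.rpow_le_rpow hw hp0
    have hn₁ := hC₂ _ hw₁ fun x hx => by
      have : x ∉ ball x₀ (2 * r) := fun h => by
        have := dist_triangle_left x₂ x₀ x
        rw [mem_ball] at h hx
        linarith
      simp [cutoff_eq_zero hr0 this]
    have hn₂ := hC₁ _ hw₂ fun x hx => by simp [cutoff_eq_one hr0 hx]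
    rw [weightedNorm_eq_eLpNorm hΩo hf hq0] at hn₁ hn₂
    calc eLpNorm (fun x => u x - c) (ENNReal.ofReal q) μ
        = eLpNorm ((fun x => (1 - cutoff x₀ r x) * (u x - c)) +
            fun x => cutoff x₀ r x * (u x - c)) (ENNReal.ofReal q) μ := by
          congr 1
          ext x
          simp only [Pi.add_apply]
          ring
      _ ≤ _ := eLpNorm_add_le (haesm _ hw₂) (haesm _ hw₁) hq1
      _ ≤ C₁ * ((K : ℝ≥0∞) ^ (1 / p) * fracSeminorm Ω g p δ τ u) +
          C₂ * ((K : ℝ≥0∞) ^ (1 / p) * fracSeminorm Ω g p δ τ u) := by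
        refine add_le_add (hn₂.trans ?_) (hn₁.trans ?_)
        · gcongr
          exact hE _ h₂
        · gcongr
          exact hE _ h₁
      _ = _ := by ring
  refine ⟨2 * ((C₁ + C₂) * K ^ (1 / p)), fun u hu => ?_⟩
  obtain ⟨c, hc⟩ := hmain u hu
  constructor
  · intro hfin
    rw [← integrable_weightedMeasure_iff hΩo hf hf0]
    have hlt : eLpNorm (fun x => u x - c) (ENNReal.ofReal q) μ < ∞ :=
      hc.trans_lt (by finiteness)
    have hi : Integrable (fun x => u x - c) μ :=
      MemLp.integrable hq1 ⟨haesm _ (hu.sub continuousOn_const), hlt⟩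
    -- Constants are integrable since `μ` is finite, so integrability passes from `u - c` to `u`.
    refine (hi.add (integrable_const c)).congr (ae_of_all _ fun x => ?_)
    simp
  · rw [weightedNorm_eq_eLpNorm hΩo hf hq0, ← average_weightedMeasure hΩo hf hf0]
    refine (eLpNorm_sub_average_le μ hq1 (haesm u hu) c).trans ?_
    push_cast [ENNReal.coe_rpow_of_nonneg _ hp0]
    rw [mul_assoc]
    gcongr
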